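/- For $x,y\in\mathbb R^N$ let $\mathcal F[\psi](x)=(2\pi)^{-N}\int_{\mathbb R^N}e^{-ix\cdot y}\psi(y)\,dy$, extended to $L_2(\mathbb R^N)$ by Plancherel, let $W_2^{k}(\mathbb R^N)$ be the space of $\psi\in L_2(\mathbb R^N)$ with $|x|^{k}\mathcal F[\psi](x)\in L_2(\mathbb R^N)$, and let $\mathcal V(\mathbb R^{2n})=W_2^{n+1}(\mathbb R^{2n})\cap\mathcal F[W_2^{n+1}(\mathbb R^{2n})]$ (functions with values in $\mathbb C$, up to equality almost everywhere). For $\alpha\in[0,2\pi]^n$ and $t\in\mathbb R^n$ write $t\cos\alpha=(t_1\cos\alpha_1,\dots,t_n\cos\alpha_n)$ and $t\sin\alpha=(t_1\sin\alpha_1,\dots,t_n\sin\alpha_n)$. **Theorem.** Let $\rho\in\mathcal V(\mathbb R^{2n})$. Then $\rho$ has a continuous representative, which is used below. The characteristic function $$f_\rho(x,y)=\int_{\mathbb R^n}e^{ix\cdot t}\,\rho\left(t+\tfrac y2,\,t-\tfrac y2\right)dt$$ is defined by an absolutely convergent integral for all $x,y\in\mathbb R^n$, and it is continuous, integrable and in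 $\mathcal V(\mathbb R^{2n})$. The Wigner function $$\mathcal W_\rho(q,p)=\frac1{(2\pi)^n}\int_{\mathbb R^{2n}}e^{-iq\cdot x-ip\cdot y}f_\rho(x,y)\,dx\,dy$$ is continuous and in $\mathcal V(\mathbb R^{2n})$. For every $\alpha\in[0,2\pi]^n$ and $x\in\mathbb R^n$ the two integrals $$\frac1{(2\pi)^n}\int_{\mathbb R^n}e^{-ix\cdot t}f_\rho(t\cos\alpha,t\sin\alpha)\,dt,$$ $$\frac1{(2\pi)^n}\int_{\mathbb R^{2n}}\mathcal W_\rho(q,p)\,\delta(x-q\cos\alpha-p\sin\alpha)\,dq\,dp:=\frac1{(2\pi)^n}\int_{\mathbb R^n}\mathcal W_\rho(x\cos\alpha-s\sin\alpha,\;x\sin\alpha+s\cos\alpha)\,ds$$ converge absolutely and have the same value $\omega_\rho(x,\alpha)$, called the optical quantum tomogram. For every $\alpha\in[0,2\pi]^n$ the function $\omega_\rho(\cdot,\alpha)$ is in $C(\mathbb R^n)\cap L_1(\mathbb R^n)$. -/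

import Mathlib

open MeasureTheory
open scoped FourierTransform

noncomputable section

namespace QuantumTomography

section Sobolev

variable {X : Type*} [NormedAddCommGroup X] [InnerProductSpace ℝ X] [FiniteDimensional ℝ X]
  [MeasurableSpace X] [BorelSpace X]

open Classical in
/-- The Fourier transform on `L₂(X)`, `X` Euclidean of dimension `N`, with the normalization
`F[ψ](x) = (2π)^(-N) ∫ exp(-i x·y) ψ(y) dy`, extended from nice functions to `L₂` by Plancherel.
Mathlib's `𝓕` on `L₂` has the kernel `exp(-2πi x·y)`, whence the rescaling of the argument.
The value is meaningful up to null sets; outside `L₂` it is set to `0`. -/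
def fourierL2 (ψ : X → ℂ) : X → ℂ := fun x =>
  if h : MemLp ψ 2 (volume : Measure X) then
    ((2 * Real.pi : ℝ) : ℂ)⁻¹ ^ Module.finrank ℝ X *
      (𝓕 (h.toLp ψ) : Lp ℂ 2 (volume : Measure X)) ((2 * Real.pi)⁻¹ • x)
  else 0

/-- The Sobolev space `W₂ᵏ(X)`: `ψ ∈ L₂` such that `|x|ᵏ F[ψ](x)` is square summable. -/
def MemSobolev (k : ℕ) (ψ : X → ℂ) : Prop :=
  MemLp ψ 2 (volume : Measure X) ∧
    MemLp (fun x => (‖x‖ ^ k : ℝ) • fourierL2 ψ x) 2 (volume : Measure X)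

end Sobolev

/-- `ℝ²ⁿ = ℝⁿ × ℝⁿ` with its Euclidean structure; a point is a pair `(x, y)`. -/
abbrev Phase (n : ℕ) : Type :=
  WithLp 2 (EuclideanSpace ℝ (Fin n) × EuclideanSpace ℝ (Fin n))

/-- The point `(x, y)` of `ℝ²ⁿ`. -/
abbrev mk {n : ℕ} (x y : EuclideanSpace ℝ (Fin n)) : Phase n := WithLp.toLp 2 (x, y)

/-- The space `𝒱(ℝ²ⁿ) = W₂ⁿ⁺¹(ℝ²ⁿ) ∩ F[W₂ⁿ⁺¹(ℝ²ⁿ)]`; functions are considered up to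
equality almost everywhere. -/
def MemV {n : ℕ} (ψ : Phase n → ℂ) : Prop :=
  MemSobolev (n + 1) ψ ∧
    ∃ φ : Phase n → ℂ, MemSobolev (n + 1) φ ∧ ψ =ᵐ[volume] fourierL2 φ

/-- The vector `(t₁ cos α₁, …, tₙ cos αₙ)`. -/
def cosVec {n : ℕ} (α : Fin n → ℝ) (t : EuclideanSpace ℝ (Fin n)) : EuclideanSpace ℝ (Fin n) :=
  WithLp.toLp 2 fun j => t j * Real.cos (α j)

/-- The vector `(t₁ sin α₁, …, tₙ sin αₙ)`. -/
def sinVec {n : ℕ} (α : Fin n → ℝ) (t : EuclideanSpace ℝ (Fin n)) : EuclideanSpace ℝ (Fin n) :=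
  WithLp.toLp 2 fun j => t j * Real.sin (α j)

/-- The characteristic function of a kernel,
`f_ρ(x, y) = ∫ exp(i x·t) ρ(t + y/2, t - y/2) dt`. -/
def charFn {n : ℕ} (ρ : Phase n → ℂ) (z : Phase n) : ℂ :=
  ∫ t : EuclideanSpace ℝ (Fin n),
    Complex.exp (Complex.I * (inner ℝ z.fst t : ℝ)) *
      ρ (mk (t + (1 / 2 : ℝ) • z.snd) (t - (1 / 2 : ℝ) • z.snd))

/-- The Wigner function of a characteristic function `f`,
`W(q, p) = (2π)⁻ⁿ ∫∫ exp(-i (q·x + p·y)) f(x, y) dx dy`. -/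
def wigner {n : ℕ} (f : Phase n → ℂ) (w : Phase n) : ℂ :=
  ((2 * Real.pi : ℝ) : ℂ)⁻¹ ^ n *
    ∫ z : Phase n,
      Complex.exp (-(Complex.I * ((inner ℝ w.fst z.fst + inner ℝ w.snd z.snd : ℝ) : ℂ))) * f z

/-- The tomogram as the Fourier transform of the restriction of `f`,
`(2π)⁻ⁿ ∫ exp(-i x·t) f(t cos α, t sin α) dt`. -/
def tomogramFourier {n : ℕ} (f : Phase n → ℂ) (α : Fin n → ℝ) (x : EuclideanSpace ℝ (Fin n)) : ℂ :=
  ((2 * Real.pi : ℝ) : ℂ)⁻¹ ^ n *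
    ∫ t : EuclideanSpace ℝ (Fin n),
      Complex.exp (-(Complex.I * (inner ℝ x t : ℝ))) * f (mk (cosVec α t) (sinVec α t))

/-- The isometric parametrization, by `s ∈ ℝⁿ`, of the `n`-plane
`{(q, p) | q cos α + p sin α = x}` in `ℝ²ⁿ`:
`q = x cos α - s sin α`, `p = x sin α + s cos α`. -/
def planePoint {n : ℕ} (α : Fin n → ℝ) (x s : EuclideanSpace ℝ (Fin n)) : Phase n :=
  mk (cosVec α x - sinVec α s) (sinVec α x + cosVec α s)

/-- The tomogram as the Radon transform of `W`,
`(2π)⁻ⁿ ∫∫ W(q, p) δ(x - q cos α - p sin α) dq dp`. As `(x, s) ↦ (q, p)` is a rotation in each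
coordinate plane `(qⱼ, pⱼ)`, with unit Jacobian, this is the integral of `W` over the `n`-plane
`q cos α + p sin α = x` with respect to its Lebesgue measure `ds`. -/
def tomogramRadon {n : ℕ} (W : Phase n → ℂ) (α : Fin n → ℝ) (x : EuclideanSpace ℝ (Fin n)) : ℂ :=
  ((2 * Real.pi : ℝ) : ℂ)⁻¹ ^ n *
    ∫ s : EuclideanSpace ℝ (Fin n), W (planePoint α x s)

end QuantumTomography

end

open QuantumTomography

/-!
# The optical quantum tomogram

A function in `𝒱` has, up to null sets, a continuous representative `h` such that `(1 + |z|)ⁿ⁺¹ h`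
and `(1 + |ξ|)ⁿ⁺¹ 𝓕 h` are square integrable (`Regular`, `MemV.exists_regular`), and conversely
(`Regular.memV`). As `2n < 2(n + 1)`, Cauchy–Schwarz makes `h` and `𝓕 h` integrable. This class is
stable under linear changes of variables and under `𝓕`; the point is that it is also stable under the
*partial* Fourier transforms of `ℝⁿ × ℝⁿ` (`Regular.regular_fourierSnd`, `Regular.regular_fourierFst`).

Indeed let `H(t, η)` be the Fourier transform of `h(t, y)` in `y`. Plancherel in `y` shows that `H`
has the decay of `h` in `t`; the Fourier transform of `H` in `t` is `𝓕 h`, so Plancherel in `t` shows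
that `H` has the decay of `𝓕 h` in `η`. Hence `H` satisfies the same weighted `L²` bound and is
integrable over `ℝ²ⁿ`. Fourier inversion in `y` then bounds `|h(t, y)|`, for all `y` at once, by the
integrable function `∫ |H(t, η)| dη` of `t` (`exists_majorant`). This is the trace theorem behind
every pointwise claim: `h` is integrable on each plane `y = const`, and the Fourier transform of `h`
in `t` is given by a dominated integral, so is continuous. By a rotation of `ℝ²ⁿ` the same holds on
the planes that carry the tomogram.

The characteristic function is a partial Fourier transform of `ρ` in the coordinates
`(t + y/2, t - y/2)`, and the Wigner function a full Fourier transform of it, so both are regular. The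
two formulas for the tomogram agree by the projection-slice theorem (`integral_fourier_slice`),
applied after rotating by `α`.
-/

open QuantumTomography

namespace QuantumTomography

set_option linter.unusedSectionVars false

/-! ### Fourier integrals and Plancherel on `L¹ ∩ L²` -/

section Plancherel

variable {X : Type*} [NormedAddCommGroup X] [InnerProductSpace ℝ X] [FiniteDimensional ℝ X]
  [MeasurableSpace X] [BorelSpace X]

theorem continuous_fourier {f : X → ℂ} (hf : Integrable f) : Continuous (𝓕 f) :=
  VectorFourier.fourierIntegral_continuous Real.continuous_fourierChar
    (by exact continuous_inner) hf

theorem continuous_fourierInv {f : X → ℂ} (hf : Integrable f) : Continuous (𝓕⁻ f) := by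
  have h : 𝓕⁻ f = fun w => 𝓕 f (-w) := by
    ext w; exact Real.fourierInv_eq_fourier_neg f w
  rw [h]
  exact (continuous_fourier hf).comp continuous_neg

theorem integral_fourier_mul {f g : X → ℂ} (hf : Integrable f) (hg : Integrable g) :
    ∫ x, 𝓕 f x * g x = ∫ x, f x * 𝓕 g x := by
  have h := VectorFourier.integral_fourierIntegral_smul_eq_flip (L := innerₗ X)
    (μ := volume) (ν := volume) Real.continuous_fourierChar continuous_inner hf hg
  rw [flip_innerₗ] at h
  exact h

theorem integral_fourierInv_mul {f g : X → ℂ} (hf : Integrable f) (hg : Integrable g) :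
    ∫ x, 𝓕⁻ f x * g x = ∫ x, f x * 𝓕⁻ g x := by
  simp only [Real.fourierInv_eq_fourier_neg]
  rw [← integral_neg_eq_self (fun x => 𝓕 f (-x) * g x)]
  simp only [neg_neg]
  rw [integral_fourier_mul hf hg.comp_neg]
  simp only [← Real.fourierInv_eq_fourier_comp_neg, Real.fourierInv_eq_fourier_neg]

/-- An `L²` function is determined by the tempered distribution it defines: if pairing it with any
Schwartz function gives the same value as pairing `u`, then it equals `u` almost everywhere. -/
theorem ae_eq_of_toTemperedDistribution_eq {G : Lp ℂ 2 (volume : Measure X)} {u : X → ℂ}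
    (hu : LocallyIntegrable u)
    (h : ∀ s : SchwartzMap X ℂ, Lp.toTemperedDistribution G s = ∫ x, s x * u x) :
    G =ᵐ[volume] u := by
  refine ae_eq_of_integral_contDiff_smul_eq ((Lp.memLp G).locallyIntegrable (by norm_num)) hu
    fun g g_smooth g_cpt => ?_
  have hg₁ : HasCompactSupport (Complex.ofRealCLM ∘ g) := g_cpt.comp_left rfl
  have hg₂ : ContDiff ℝ (⊤ : ℕ∞) (Complex.ofRealCLM ∘ g) :=
    Complex.ofRealCLM.contDiff.comp g_smooth
  simpa using h (hg₁.toSchwartzMap hg₂)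

/-- On `L¹ ∩ L²` the Fourier transform defined by Plancherel is the Fourier integral. -/
theorem fourier_toLp_ae_eq {f : X → ℂ} (h1 : Integrable f) (h2 : MemLp f 2) :
    (𝓕 (h2.toLp f) : Lp ℂ 2 (volume : Measure X)) =ᵐ[volume] 𝓕 f := by
  refine ae_eq_of_toTemperedDistribution_eq (continuous_fourier h1).locallyIntegrable fun s => ?_
  rw [← Lp.fourier_toTemperedDistribution_eq, TemperedDistribution.fourier_apply,
    Lp.toTemperedDistribution_apply, ← integral_fourier_mul s.integrable h1]
  apply integral_congr_ae
  filter_upwards [h2.coeFn_toLp] with x hx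
  rw [hx, SchwartzMap.fourier_coe, smul_eq_mul]

theorem fourierInv_toLp_ae_eq {f : X → ℂ} (h1 : Integrable f) (h2 : MemLp f 2) :
    (𝓕⁻ (h2.toLp f) : Lp ℂ 2 (volume : Measure X)) =ᵐ[volume] 𝓕⁻ f := by
  refine ae_eq_of_toTemperedDistribution_eq (continuous_fourierInv h1).locallyIntegrable fun s => ?_
  rw [← Lp.fourierInv_toTemperedDistribution_eq, TemperedDistribution.fourierInv_apply,
    Lp.toTemperedDistribution_apply, ← integral_fourierInv_mul s.integrable h1]
  apply integral_congr_ae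
  filter_upwards [h2.coeFn_toLp] with x hx
  rw [hx, SchwartzMap.fourierInv_coe, smul_eq_mul]

theorem eLpNorm_fourier {f : X → ℂ} (h1 : Integrable f) (h2 : MemLp f 2) :
    eLpNorm (𝓕 f) 2 = eLpNorm f 2 := by
  rw [← eLpNorm_congr_ae (fourier_toLp_ae_eq h1 h2), ← Lp.enorm_def,
    ← eLpNorm_congr_ae h2.coeFn_toLp, ← Lp.enorm_def, ← ofReal_norm, ← ofReal_norm,
    Lp.norm_fourier_eq]

theorem eLpNorm_two_sq {Y : Type*} [MeasurableSpace Y] {μ : Measure Y} (f : Y → ℂ) :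
    eLpNorm f 2 μ ^ 2 = ∫⁻ x, ‖f x‖ₑ ^ 2 ∂μ := by
  have h := eLpNorm_nnreal_pow_eq_lintegral (μ := μ) (f := f) (p := 2) two_ne_zero
  norm_num at h
  exact_mod_cast h

theorem memLp_two_iff {Y : Type*} [MeasurableSpace Y] {μ : Measure Y} {f : Y → ℂ}
    (hf : AEStronglyMeasurable f μ) : MemLp f 2 μ ↔ ∫⁻ x, ‖f x‖ₑ ^ 2 ∂μ < ⊤ := by
  rw [← eLpNorm_two_sq, MemLp, and_iff_right hf]
  rw [ENNReal.pow_lt_top_iff]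
  simp only [OfNat.ofNat_ne_zero, or_false]

theorem lintegral_fourier_sq {f : X → ℂ} (h1 : Integrable f) (h2 : MemLp f 2) :
    ∫⁻ x, ‖𝓕 f x‖ₑ ^ 2 = ∫⁻ x, ‖f x‖ₑ ^ 2 := by
  rw [← eLpNorm_two_sq, ← eLpNorm_two_sq, eLpNorm_fourier h1 h2]

end Plancherel

/-! ### Weighted `L²` functions and their linear changes of variables -/

section Regular

variable {X : Type*} [NormedAddCommGroup X] [InnerProductSpace ℝ X] [FiniteDimensional ℝ X]
  [MeasurableSpace X] [BorelSpace X]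
variable {Y : Type*} [NormedAddCommGroup Y] [InnerProductSpace ℝ Y] [FiniteDimensional ℝ Y]
  [MeasurableSpace Y] [BorelSpace Y]

/-- `(1 + |z|)ᵏ h ∈ L²(X)`. -/
def Weighted (k : ℕ) (h : X → ℂ) : Prop :=
  MemLp (fun z => ((1 + ‖z‖) ^ k : ℝ) • h z) 2 (volume : Measure X)

/-- Continuous functions `h` such that both `(1 + |z|)ᵏ h` and `(1 + |ξ|)ᵏ 𝓕 h` are in `L²(X)`, where
`𝓕` is the Fourier integral. For `dim X < 2k` such `h` and `𝓕 h` are integrable. -/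
structure Regular (k : ℕ) (h : X → ℂ) : Prop where
  continuous : Continuous h
  weighted : Weighted k h
  weighted_fourier : Weighted k (𝓕 h)

variable {k : ℕ} {h : X → ℂ}

theorem aestronglyMeasurable_weight (k : ℕ) :
    AEStronglyMeasurable (fun z : X => ((1 + ‖z‖) ^ k : ℝ)) :=
  Measurable.aestronglyMeasurable (by fun_prop)

theorem Weighted.aestronglyMeasurable (hh : Weighted k h) : AEStronglyMeasurable h := by
  have h1 : AEStronglyMeasurable (fun z : X => ((1 + ‖z‖) ^ k : ℝ)⁻¹) :=
    (Measurable.aestronglyMeasurable (by fun_prop))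
  refine (h1.smul hh.1).congr (ae_of_all _ fun z => ?_)
  have : ((1 + ‖z‖) ^ k : ℝ) ≠ 0 := by positivity
  exact inv_smul_smul₀ this _

theorem Weighted.congr_ae {g : X → ℂ} (hh : Weighted k h) (hg : h =ᵐ[volume] g) :
    Weighted k g := by
  refine (memLp_congr_ae ?_).1 hh
  filter_upwards [hg] with z hz
  rw [hz]

theorem Weighted.memLp (hh : Weighted k h) : MemLp h 2 := by
  refine hh.mono hh.aestronglyMeasurable (ae_of_all _ fun z => ?_)
  rw [norm_smul, Real.norm_of_nonneg (by positivity)]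
  exact le_mul_of_one_le_left (norm_nonneg _) (one_le_pow₀ (by simp))

/-- Cauchy–Schwarz against `(1 + |z|)⁻ᵏ`, which is in `L²(X)` because `dim X < 2k`. -/
theorem Weighted.integrable (hk : Module.finrank ℝ X < 2 * k) (hh : Weighted k h) :
    Integrable h := by
  have h1 : MemLp (fun z : X => (((1 + ‖z‖) ^ k)⁻¹ : ℝ)) 2 := by
    rw [memLp_two_iff_integrable_sq (Measurable.aestronglyMeasurable (by fun_prop))]
    refine (integrable_one_add_norm (r := ((2 * k : ℕ) : ℝ)) (by exact_mod_cast hk)).congr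
      (ae_of_all _ fun z => ?_)
    simp only
    rw [Real.rpow_neg (by positivity), Real.rpow_natCast, inv_pow, ← pow_mul, mul_comm k]
  have h2 : MemLp ((fun z : X => (((1 + ‖z‖) ^ k)⁻¹ : ℝ)) •
      fun z : X => ((1 + ‖z‖) ^ k : ℝ) • h z) 1 := hh.smul h1
  refine (memLp_one_iff_integrable.1 h2).congr (ae_of_all _ fun z => ?_)
  have : ((1 + ‖z‖) ^ k : ℝ) ≠ 0 := by positivity
  exact inv_smul_smul₀ this _

theorem Weighted.const_mul (hh : Weighted k h) (c : ℂ) : Weighted k (fun z => c * h z) := by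
  have := MemLp.const_mul hh c
  simpa only [Weighted, mul_smul_comm] using this

/-- The weight `(1 + |z|)ᵏ` amounts to the two weights `1` and `|z|ᵏ` of the Sobolev condition. -/
theorem weighted_iff : Weighted k h ↔ MemLp h 2 ∧ MemLp (fun z => (‖z‖ ^ k : ℝ) • h z) 2 := by
  refine ⟨fun hh => ⟨hh.memLp, hh.mono ?_ (ae_of_all _ fun z => ?_)⟩, fun ⟨h1, h2⟩ => ?_⟩
  · exact (show AEStronglyMeasurable (fun z : X => (‖z‖ ^ k : ℝ)) from
      Measurable.aestronglyMeasurable (by fun_prop)).smul hh.aestronglyMeasurable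
  · rw [norm_smul, norm_smul, Real.norm_of_nonneg (by positivity),
      Real.norm_of_nonneg (by positivity)]
    gcongr
    linarith
  · -- `add_pow_le` gives `(1 + |z|)ᵏ ≤ 2ᵏ⁻¹ (1 + |z|ᵏ)`; for `k = 0` the exponent is `0`.
    have h3 := (h1.norm.add h2.norm).const_mul (2 ^ (k - 1) : ℝ)
    refine h3.mono ((aestronglyMeasurable_weight k).smul h1.1)
      (ae_of_all _ fun z => ?_)
    have h4 := add_pow_le zero_le_one (norm_nonneg z) k
    rw [one_pow] at h4
    simp only [Pi.add_apply, norm_smul, norm_mul, norm_pow, norm_norm]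
    rw [Real.norm_of_nonneg (by positivity : (0 : ℝ) ≤ 1 + ‖z‖),
      Real.norm_of_nonneg (by positivity : (0 : ℝ) ≤ 2),
      Real.norm_of_nonneg (by positivity : (0 : ℝ) ≤ ‖h z‖ + ‖z‖ ^ k * ‖h z‖)]
    calc (1 + ‖z‖) ^ k * ‖h z‖ ≤ (2 ^ (k - 1) * (1 + ‖z‖ ^ k)) * ‖h z‖ := by gcongr
      _ = _ := by ring

theorem exists_map_volume_eq (A : X ≃L[ℝ] Y) :
    ∃ c : NNReal, Measure.map A (volume : Measure X) = c • (volume : Measure Y) := by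
  have := A.isAddHaarMeasure_map (volume : Measure X)
  exact ⟨_, Measure.isAddLeftInvariant_eq_smul _ _⟩

theorem memLp_comp_linearEquiv {h : Y → ℂ} (A : X ≃L[ℝ] Y) (hh : MemLp h 2) :
    MemLp (h ∘ A) 2 := by
  obtain ⟨c, hc⟩ := exists_map_volume_eq A
  have h1 : MemLp h 2 (Measure.map A (volume : Measure X)) := by
    rw [hc]
    exact hh.smul_measure ENNReal.coe_ne_top
  exact h1.comp_of_map A.continuous.aemeasurable

theorem exists_integral_comp_eq (A : X ≃L[ℝ] Y) :
    ∃ c : NNReal, ∀ h : Y → ℂ, ∫ x, h (A x) = (c : ℂ) * ∫ y, h y := by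
  obtain ⟨c, hc⟩ := exists_map_volume_eq A
  refine ⟨c, fun h => ?_⟩
  have h1 : ∫ y, h y ∂(Measure.map A (volume : Measure X)) = ∫ x, h (A x) :=
    A.toHomeomorph.measurableEmbedding.integral_map h
  rw [← h1, hc, integral_smul_nnreal_measure]
  rfl

theorem Weighted.comp {h : Y → ℂ} (hh : Weighted k h) (A : X ≃L[ℝ] Y) :
    Weighted k (h ∘ A) := by
  have h1 := memLp_comp_linearEquiv A hh
  have h2 := memLp_comp_linearEquiv A hh.memLp
  refine h1.of_le_mul (c := (1 + ‖(A.symm : Y →L[ℝ] X)‖) ^ k)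
    ((aestronglyMeasurable_weight k).smul h2.1) (ae_of_all _ fun z => ?_)
  simp only [Function.comp_apply, norm_smul]
  rw [Real.norm_of_nonneg (by positivity), Real.norm_of_nonneg (by positivity), ← mul_assoc,
    ← mul_pow]
  gcongr
  have h3 := (A.symm : Y →L[ℝ] X).le_opNorm (A z)
  simp only [ContinuousLinearEquiv.coe_coe, ContinuousLinearEquiv.symm_apply_apply] at h3
  nlinarith [norm_nonneg (A z), norm_nonneg (A.symm : Y →L[ℝ] X)]

/-- The inverse transpose of a linear equivalence of Euclidean spaces. -/
noncomputable def inverseAdjoint (A : X ≃L[ℝ] Y) : X ≃L[ℝ] Y :=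
  ContinuousLinearEquiv.equivOfInverse (A.symm : Y →L[ℝ] X).adjoint (A : X →L[ℝ] Y).adjoint
    (fun x => ext_inner_right ℝ fun v => by simp [ContinuousLinearMap.adjoint_inner_left])
    (fun x => ext_inner_right ℝ fun v => by simp [ContinuousLinearMap.adjoint_inner_left])

theorem inner_inverseAdjoint (A : X ≃L[ℝ] Y) (x w : X) :
    inner ℝ (A x) (inverseAdjoint A w) = inner ℝ x w := by
  change inner ℝ (A x) ((A.symm : Y →L[ℝ] X).adjoint w) = _
  rw [ContinuousLinearMap.adjoint_inner_right]
  simp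

/-- The Fourier transform of `h ∘ A` is `𝓕 h` composed with the inverse transpose of `A`, up to the
Jacobian factor `c`. -/
theorem exists_fourier_comp_eq (A : X ≃L[ℝ] Y) :
    ∃ c : ℂ, ∀ h : Y → ℂ, 𝓕 (h ∘ A) = fun w => c * 𝓕 h (inverseAdjoint A w) := by
  obtain ⟨c, hc⟩ := exists_integral_comp_eq A
  refine ⟨c, fun h => funext fun w => ?_⟩
  rw [Real.fourier_eq, Real.fourier_eq, ← hc]
  simp only [inner_inverseAdjoint, Function.comp_apply]

theorem Regular.comp {h : Y → ℂ} (hh : Regular k h) (A : X ≃L[ℝ] Y) :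
    Regular k (h ∘ A) := by
  refine ⟨hh.continuous.comp A.continuous, hh.weighted.comp A, ?_⟩
  obtain ⟨c, hc⟩ := exists_fourier_comp_eq A
  rw [hc]
  exact (hh.weighted_fourier.comp (inverseAdjoint A)).const_mul c

theorem fourier_const_mul (c : ℂ) (h : X → ℂ) :
    𝓕 (fun z => c * h z) = fun w => c * 𝓕 h w := by
  ext w
  simp only [Real.fourier_eq, ← integral_const_mul, mul_smul_comm]

theorem Regular.const_mul (hh : Regular k h) (c : ℂ) : Regular k (fun z => c * h z) := by
  refine ⟨continuous_const.mul hh.continuous, hh.weighted.const_mul c, ?_⟩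
  rw [fourier_const_mul]
  exact hh.weighted_fourier.const_mul c

theorem fourier_fourier_eq (hc : Continuous h) (h1 : Integrable h) (h2 : Integrable (𝓕 h)) (x : X) :
    𝓕 (𝓕 h) x = h (-x) := by
  have h3 := congrFun (hc.fourierInv_fourier_eq h1 h2) (-x)
  rwa [Real.fourierInv_eq_fourier_neg, neg_neg] at h3

theorem Regular.fourier (hk : Module.finrank ℝ X < 2 * k) (hh : Regular k h) :
    Regular k (𝓕 h) := by
  have h1 := hh.weighted.integrable hk
  have h2 := hh.weighted_fourier.integrable hk
  refine ⟨continuous_fourier h1, hh.weighted_fourier, ?_⟩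
  have h3 : 𝓕 (𝓕 h) = h ∘ ContinuousLinearEquiv.neg ℝ (M := X) :=
    funext fun x => fourier_fourier_eq hh.continuous h1 h2 x
  rw [h3]
  exact hh.weighted.comp _

end Regular

/-! ### Partial Fourier transforms on a product -/

section Product

variable {E : Type*} [NormedAddCommGroup E] [InnerProductSpace ℝ E] [FiniteDimensional ℝ E]
  [MeasurableSpace E] [BorelSpace E]
variable {F : Type*} [NormedAddCommGroup F] [InnerProductSpace ℝ F] [FiniteDimensional ℝ F]
  [MeasurableSpace F] [BorelSpace F]

theorem measurableEmbedding_toLp : MeasurableEmbedding (@WithLp.toLp 2 (E × F)) :=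
  (MeasurableEquiv.toLp 2 (E × F)).measurableEmbedding

theorem integrable_comp_toLp_iff {f : WithLp 2 (E × F) → ℂ} :
    Integrable (fun p : E × F => f (WithLp.toLp 2 p)) (volume.prod volume) ↔ Integrable f :=
  (WithLp.volume_preserving_toLp E F).integrable_comp_emb measurableEmbedding_toLp

theorem integral_comp_toLp (f : WithLp 2 (E × F) → ℂ) :
    ∫ p : E × F, f (WithLp.toLp 2 p) ∂(volume.prod volume) = ∫ z, f z :=
  (WithLp.volume_preserving_toLp E F).integral_comp measurableEmbedding_toLp f

theorem lintegral_withLp_prod {f : WithLp 2 (E × F) → ENNReal} (hf : Measurable f) :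
    ∫⁻ z, f z = ∫⁻ x : E, ∫⁻ y : F, f (WithLp.toLp 2 (x, y)) := by
  rw [← (WithLp.volume_preserving_toLp E F).lintegral_comp hf]
  exact lintegral_prod (μ := volume) (ν := volume) _ (by fun_prop)

theorem lintegral_withLp_prod_symm {f : WithLp 2 (E × F) → ENNReal} (hf : Measurable f) :
    ∫⁻ z, f z = ∫⁻ y : F, ∫⁻ x : E, f (WithLp.toLp 2 (x, y)) := by
  rw [← (WithLp.volume_preserving_toLp E F).lintegral_comp hf]
  exact lintegral_prod_symm (μ := volume) (ν := volume) _ (by fun_prop)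

/-- The weight `(1 + |x|)²ᵏ`, for lower Lebesgue integrals of `|h|²`. -/
noncomputable def weight {X : Type*} [NormedAddCommGroup X] (k : ℕ) (x : X) : ENNReal :=
  ‖((1 + ‖x‖) ^ k : ℝ)‖ₑ ^ 2

theorem measurable_weight {X : Type*} [NormedAddCommGroup X] [MeasurableSpace X] [BorelSpace X]
    (k : ℕ) : Measurable (weight k : X → ENNReal) := by
  unfold weight; fun_prop

theorem memLp_smul_weight_iff {Z X : Type*} [MeasurableSpace Z] {μ : Measure Z}
    [NormedAddCommGroup X] [MeasurableSpace X] [BorelSpace X] {k : ℕ}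
    {p : Z → X} (hp : Measurable p) {g : Z → ℂ} (hg : AEStronglyMeasurable g μ) :
    MemLp (fun z => ((1 + ‖p z‖) ^ k : ℝ) • g z) 2 μ ↔ ∫⁻ z, weight k (p z) * ‖g z‖ₑ ^ 2 ∂μ < ⊤ := by
  rw [memLp_two_iff]
  · simp only [weight, enorm_smul, mul_pow]
  · refine AEStronglyMeasurable.smul (f := fun z => ((1 + ‖p z‖) ^ k : ℝ)) ?_ hg
    exact Measurable.aestronglyMeasurable (by fun_prop)

/-- On a product, the weight in `|z|` splits into a weight in each variable. Each of the two can be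
followed through a Fourier transform in the other variable. -/
theorem weighted_prod_iff {k : ℕ} {g : WithLp 2 (E × F) → ℂ} (hg : AEStronglyMeasurable g) :
    Weighted k g ↔ ∫⁻ z, weight k z.fst * ‖g z‖ₑ ^ 2 < ⊤ ∧ ∫⁻ z, weight k z.snd * ‖g z‖ₑ ^ 2 < ⊤ := by
  have hfst : Measurable (fun z : WithLp 2 (E × F) => z.fst) := by fun_prop
  have hsnd : Measurable (fun z : WithLp 2 (E × F) => z.snd) := by fun_prop
  rw [← memLp_smul_weight_iff hfst hg, ← memLp_smul_weight_iff hsnd hg]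
  constructor
  · intro h
    constructor
    · refine h.mono ((show AEStronglyMeasurable
        (fun z : WithLp 2 (E × F) => ((1 + ‖z.fst‖) ^ k : ℝ)) from
          Measurable.aestronglyMeasurable (by fun_prop)).smul hg) (ae_of_all _ fun z => ?_)
      rw [norm_smul, norm_smul, Real.norm_of_nonneg (by positivity),
        Real.norm_of_nonneg (by positivity)]
      gcongr
      exact WithLp.norm_fst_le ..
    · refine h.mono ((show AEStronglyMeasurable
        (fun z : WithLp 2 (E × F) => ((1 + ‖z.snd‖) ^ k : ℝ)) from
          Measurable.aestronglyMeasurable (by fun_prop)).smul hg) (ae_of_all _ fun z => ?_)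
      rw [norm_smul, norm_smul, Real.norm_of_nonneg (by positivity),
        Real.norm_of_nonneg (by positivity)]
      gcongr
      exact WithLp.norm_snd_le ..
  · rintro ⟨h1, h2⟩
    have h3 := (h1.norm.add h2.norm).const_mul (2 ^ (k - 1) : ℝ)
    refine h3.mono ((aestronglyMeasurable_weight k).smul hg) (ae_of_all _ fun z => ?_)
    have h5 : ‖z‖ ≤ ‖z.fst‖ + ‖z.snd‖ := by
      rw [WithLp.prod_norm_eq_of_L2]
      exact Real.sqrt_le_iff.2 ⟨by positivity, by
        nlinarith [mul_nonneg (norm_nonneg z.fst) (norm_nonneg z.snd)]⟩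
    have h4 := add_pow_le (by positivity : 0 ≤ 1 + ‖z.fst‖) (by positivity : 0 ≤ 1 + ‖z.snd‖) k
    simp only [Pi.add_apply, norm_smul, norm_mul, norm_pow]
    rw [Real.norm_of_nonneg (by positivity : (0 : ℝ) ≤ 1 + ‖z‖),
      Real.norm_of_nonneg (by positivity : (0 : ℝ) ≤ 1 + ‖z.fst‖),
      Real.norm_of_nonneg (by positivity : (0 : ℝ) ≤ 1 + ‖z.snd‖),
      Real.norm_of_nonneg (by positivity : (0 : ℝ) ≤ 2),
      Real.norm_of_nonneg (by positivity :
        (0 : ℝ) ≤ (1 + ‖z.fst‖) ^ k * ‖g z‖ + (1 + ‖z.snd‖) ^ k * ‖g z‖)]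
    calc (1 + ‖z‖) ^ k * ‖g z‖
        ≤ ((1 + ‖z.fst‖) + (1 + ‖z.snd‖)) ^ k * ‖g z‖ := by gcongr ?_ ^ k * _; linarith
      _ ≤ (2 ^ (k - 1) * ((1 + ‖z.fst‖) ^ k + (1 + ‖z.snd‖) ^ k)) * ‖g z‖ := by gcongr
      _ = _ := by ring

/-- Fourier transform in the second variable. -/
noncomputable def fourierSnd (h : WithLp 2 (E × F) → ℂ) (z : WithLp 2 (E × F)) : ℂ :=
  𝓕 (fun y : F => h (WithLp.toLp 2 (z.fst, y))) z.snd

/-- Fourier transform in the first variable. -/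
noncomputable def fourierFst (h : WithLp 2 (E × F) → ℂ) (z : WithLp 2 (E × F)) : ℂ :=
  𝓕 (fun x : E => h (WithLp.toLp 2 (x, z.snd))) z.fst

theorem stronglyMeasurable_fourierSnd {h : WithLp 2 (E × F) → ℂ} (hh : Continuous h) :
    StronglyMeasurable (fourierSnd h) := by
  have h1 : Continuous (fun p : WithLp 2 (E × F) × F =>
      Real.fourierChar (-inner ℝ p.2 p.1.snd) • h (WithLp.toLp 2 (p.1.fst, p.2))) := by
    fun_prop
  exact h1.stronglyMeasurable.integral_prod_right

theorem integrable_fourierSnd_kernel {h : WithLp 2 (E × F) → ℂ} (hh : Integrable h) (η : F) :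
    Integrable (fun p : E × F => Real.fourierChar (-inner ℝ p.2 η) • h (WithLp.toLp 2 p))
      (volume.prod volume) := by
  refine (integrable_comp_toLp_iff.2 hh).mono ?_ (ae_of_all _ fun p => by simp)
  exact AEStronglyMeasurable.smul (f := fun p : E × F => Real.fourierChar (-inner ℝ p.2 η))
    (Continuous.aestronglyMeasurable (by fun_prop)) (integrable_comp_toLp_iff.2 hh).1

/-- Unlike the slices `y ↦ h (x, y)`, these are integrable for every frequency `η`: the absolute value
is at most `∫ |h (x, y)| dy`. -/
theorem integrable_fourierSnd_left {h : WithLp 2 (E × F) → ℂ} (hh : Integrable h) (η : F) :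
    Integrable (fun x : E => fourierSnd h (WithLp.toLp 2 (x, η))) :=
  (integrable_fourierSnd_kernel hh η).integral_prod_left

theorem fourierFst_fourierSnd {h : WithLp 2 (E × F) → ℂ} (hh : Integrable h) :
    fourierFst (fourierSnd h) = 𝓕 h := by
  ext w
  have h1 : Integrable (fun z : WithLp 2 (E × F) => Real.fourierChar (-inner ℝ z w) • h z) :=
    (Real.fourierIntegral_convergent_iff w).2 hh
  rw [Real.fourier_eq, ← integral_comp_toLp, integral_prod _ (integrable_comp_toLp_iff.2 h1)]
  simp only [fourierFst, fourierSnd, Real.fourier_eq]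
  congr 1 with x
  rw [Circle.smul_def, ← integral_smul]
  congr 1 with y
  simp only [Circle.smul_def, smul_smul, WithLp.prod_inner_apply, neg_add,
    AddChar.map_add_eq_mul, Circle.coe_mul]
  rfl

theorem ae_memLp_slice_right {h : WithLp 2 (E × F) → ℂ} (hm : StronglyMeasurable h)
    (h2 : MemLp h 2) : ∀ᵐ x : E, MemLp (fun y : F => h (WithLp.toLp 2 (x, y))) 2 := by
  have hm2 : Measurable (fun z => ‖h z‖ₑ ^ 2) := hm.measurable.enorm.pow_const 2
  have h3 := (memLp_two_iff h2.1).1 h2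
  rw [lintegral_withLp_prod hm2] at h3
  have h4 : Measurable (fun x : E => ∫⁻ y : F, ‖h (WithLp.toLp 2 (x, y))‖ₑ ^ 2) :=
    (hm2.comp (by fun_prop : Measurable fun p : E × F => WithLp.toLp 2 p)).lintegral_prod_right'
  filter_upwards [ae_lt_top h4 h3.ne] with x hx
  exact (memLp_two_iff (hm.measurable.comp
    (by fun_prop : Measurable fun y : F => WithLp.toLp 2 (x, y))).aestronglyMeasurable).2 hx

theorem ae_memLp_slice_left {h : WithLp 2 (E × F) → ℂ} (hm : StronglyMeasurable h)
    (h2 : MemLp h 2) : ∀ᵐ y : F, MemLp (fun x : E => h (WithLp.toLp 2 (x, y))) 2 := by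
  have hm2 : Measurable (fun z => ‖h z‖ₑ ^ 2) := hm.measurable.enorm.pow_const 2
  have h3 := (memLp_two_iff h2.1).1 h2
  rw [lintegral_withLp_prod_symm hm2] at h3
  have h4 : Measurable (fun y : F => ∫⁻ x : E, ‖h (WithLp.toLp 2 (x, y))‖ₑ ^ 2) :=
    (hm2.comp (by fun_prop : Measurable fun p : E × F => WithLp.toLp 2 p)).lintegral_prod_left'
  filter_upwards [ae_lt_top h4 h3.ne] with y hy
  exact (memLp_two_iff (hm.measurable.comp
    (by fun_prop : Measurable fun x : E => WithLp.toLp 2 (x, y))).aestronglyMeasurable).2 hy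

theorem ae_integrable_slice_right {h : WithLp 2 (E × F) → ℂ} (hh : Integrable h) :
    ∀ᵐ x : E, Integrable (fun y : F => h (WithLp.toLp 2 (x, y))) :=
  (integrable_comp_toLp_iff.2 hh).prod_right_ae

theorem weight_mul_enorm_sq_measurable {X : Type*} [NormedAddCommGroup X] [MeasurableSpace X]
    [BorelSpace X] {Z : Type*} [MeasurableSpace Z] (k : ℕ) {p : Z → X} (hp : Measurable p)
    {g : Z → ℂ} (hg : StronglyMeasurable g) :
    Measurable (fun z => weight k (p z) * ‖g z‖ₑ ^ 2) :=
  ((measurable_weight k).comp hp).mul (hg.measurable.enorm.pow_const 2)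

theorem fourierSnd_slice (h : WithLp 2 (E × F) → ℂ) (x : E) :
    (fun y : F => fourierSnd h (WithLp.toLp 2 (x, y))) =
      𝓕 (fun y : F => h (WithLp.toLp 2 (x, y))) :=
  rfl

/-- Plancherel in the second variable, for almost every value of the first. -/
theorem lintegral_weight_fst_fourierSnd {k : ℕ} {h : WithLp 2 (E × F) → ℂ} (hc : Continuous h)
    (h1 : Integrable h) (h2 : MemLp h 2) :
    ∫⁻ z, weight k z.fst * ‖fourierSnd h z‖ₑ ^ 2 = ∫⁻ z, weight k z.fst * ‖h z‖ₑ ^ 2 := by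
  have hfst : Measurable (fun z : WithLp 2 (E × F) => z.fst) := by fun_prop
  have hg := stronglyMeasurable_fourierSnd hc
  rw [lintegral_withLp_prod (weight_mul_enorm_sq_measurable k hfst hg),
    lintegral_withLp_prod (weight_mul_enorm_sq_measurable k hfst hc.stronglyMeasurable)]
  apply lintegral_congr_ae
  filter_upwards [ae_integrable_slice_right h1, ae_memLp_slice_right hc.stronglyMeasurable h2]
    with x hx1 hx2
  simp only [WithLp.toLp_fst]
  rw [lintegral_const_mul, lintegral_const_mul]
  · congr 1
    rw [← lintegral_fourier_sq hx1 hx2, ← fourierSnd_slice]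
  · exact (hc.measurable.comp
      (by fun_prop : Measurable fun y : F => WithLp.toLp 2 (x, y))).enorm.pow_const 2
  · exact (hg.measurable.comp
      (by fun_prop : Measurable fun y : F => WithLp.toLp 2 (x, y))).enorm.pow_const 2

/-- Plancherel in the first variable, for almost every value of the second: the Fourier transform of
`fourierSnd h` in the first variable is `𝓕 h`. -/
theorem lintegral_weight_snd_fourierSnd {k : ℕ} {h : WithLp 2 (E × F) → ℂ} (hc : Continuous h)
    (h1 : Integrable h) (h2 : MemLp (fourierSnd h) 2) :
    ∫⁻ z, weight k z.snd * ‖fourierSnd h z‖ₑ ^ 2 = ∫⁻ z, weight k z.snd * ‖𝓕 h z‖ₑ ^ 2 := by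
  have hsnd : Measurable (fun z : WithLp 2 (E × F) => z.snd) := by fun_prop
  have hg := stronglyMeasurable_fourierSnd hc
  have hF := (continuous_fourier h1)
  rw [lintegral_withLp_prod_symm (weight_mul_enorm_sq_measurable k hsnd hg),
    lintegral_withLp_prod_symm (weight_mul_enorm_sq_measurable k hsnd hF.stronglyMeasurable)]
  apply lintegral_congr_ae
  filter_upwards [ae_memLp_slice_left hg h2] with y hy
  simp only [WithLp.toLp_snd]
  rw [lintegral_const_mul, lintegral_const_mul]
  · congr 1
    rw [← fourierFst_fourierSnd h1]
    exact (lintegral_fourier_sq (integrable_fourierSnd_left h1 y) hy).symm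
  · exact (hF.measurable.comp
      (by fun_prop : Measurable fun x : E => WithLp.toLp 2 (x, y))).enorm.pow_const 2
  · exact (hg.measurable.comp
      (by fun_prop : Measurable fun x : E => WithLp.toLp 2 (x, y))).enorm.pow_const 2

variable {k : ℕ} {h : WithLp 2 (E × F) → ℂ}

/-- The decay of `fourierSnd h` in the first variable comes from that of `h`, its decay in the second
from that of `𝓕 h`. -/
theorem Regular.weighted_fourierSnd (hk : Module.finrank ℝ (WithLp 2 (E × F)) < 2 * k)
    (hh : Regular k h) : Weighted k (fourierSnd h) := by
  have h1 := hh.weighted.integrable hk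
  have hg := (stronglyMeasurable_fourierSnd hh.continuous).aestronglyMeasurable (μ := volume)
  have h0 := hh.weighted.memLp
  have h2 : MemLp (fourierSnd h) 2 := by
    -- The exponent `0` is Plancherel without a weight.
    have := lintegral_weight_fst_fourierSnd (k := 0) hh.continuous h1 h0
    simp only [weight, pow_zero, enorm_one, one_pow, one_mul] at this
    rw [memLp_two_iff hg, this, ← memLp_two_iff h0.1]
    exact h0
  rw [weighted_prod_iff hg, lintegral_weight_fst_fourierSnd hh.continuous h1 h0,
    lintegral_weight_snd_fourierSnd hh.continuous h1 h2]
  exact ⟨((weighted_prod_iff h0.1).1 hh.weighted).1,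
    ((weighted_prod_iff hh.weighted_fourier.aestronglyMeasurable).1 hh.weighted_fourier).2⟩

/-- The majorant is `∫ |fourierSnd h (x, η)| dη`: by Fourier inversion in the second variable it
bounds `h (x, y)` uniformly in `y`. -/
theorem exists_majorant (hk : Module.finrank ℝ (WithLp 2 (E × F)) < 2 * k) (hh : Regular k h) :
    ∃ M : E → ℝ, Integrable M ∧ ∀ᵐ x : E, ∀ y : F, ‖h (WithLp.toLp 2 (x, y))‖ ≤ M x := by
  have h1 := hh.weighted.integrable hk
  have h2 := (hh.weighted_fourierSnd hk).integrable hk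
  refine ⟨_, (integrable_comp_toLp_iff.2 h2).integral_norm_prod_left, ?_⟩
  filter_upwards [ae_integrable_slice_right h1, ae_integrable_slice_right h2] with x hx1 hx2 y
  have hc : Continuous (fun y : F => h (WithLp.toLp 2 (x, y))) :=
    hh.continuous.comp (by fun_prop)
  have h3 := congrFun (hc.fourierInv_fourier_eq hx1 hx2) y
  rw [← h3, Real.fourierInv_eq]
  refine (norm_integral_le_integral_norm _).trans_eq ?_
  simp only [Circle.norm_smul]
  rfl

/-- Trace theorem: a regular function is integrable on every plane parallel to `E`, not just on
almost every one. -/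
theorem Regular.integrable_slice_left (hk : Module.finrank ℝ (WithLp 2 (E × F)) < 2 * k)
    (hh : Regular k h) (y : F) : Integrable (fun x : E => h (WithLp.toLp 2 (x, y))) := by
  obtain ⟨M, hM, hb⟩ := exists_majorant hk hh
  have hc : Continuous (fun x : E => h (WithLp.toLp 2 (x, y))) := hh.continuous.comp (by fun_prop)
  exact hM.mono' hc.aestronglyMeasurable (hb.mono fun x hx => hx y)

theorem Regular.continuous_fourierFst (hk : Module.finrank ℝ (WithLp 2 (E × F)) < 2 * k)
    (hh : Regular k h) : Continuous (fourierFst h) := by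
  obtain ⟨M, hM, hb⟩ := exists_majorant hk hh
  unfold fourierFst
  simp only [Real.fourier_eq]
  refine continuous_of_dominated (bound := M) (fun z => ?_) (fun z => ?_) hM (ae_of_all _ fun x => ?_)
  · have := hh.continuous
    exact Continuous.aestronglyMeasurable (by fun_prop)
  · filter_upwards [hb] with x hx
    simpa using hx z.snd
  · have := hh.continuous
    fun_prop

theorem fourierFst_eq (h : WithLp 2 (E × F) → ℂ) :
    fourierFst h = fourierSnd (h ∘ LinearIsometryEquiv.withLpProdComm 2 ℝ F E) ∘
      LinearIsometryEquiv.withLpProdComm 2 ℝ E F :=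
  rfl

theorem fourierSnd_eq (h : WithLp 2 (E × F) → ℂ) :
    fourierSnd h = fourierFst (h ∘ LinearIsometryEquiv.withLpProdComm 2 ℝ F E) ∘
      LinearIsometryEquiv.withLpProdComm 2 ℝ E F :=
  rfl

theorem finrank_withLp_prod_comm :
    Module.finrank ℝ (WithLp 2 (F × E)) = Module.finrank ℝ (WithLp 2 (E × F)) :=
  (LinearIsometryEquiv.withLpProdComm 2 ℝ F E).toLinearEquiv.finrank_eq

theorem Regular.comp_prodComm (hh : Regular k h) :
    Regular k (h ∘ LinearIsometryEquiv.withLpProdComm 2 ℝ F E) :=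
  hh.comp (LinearIsometryEquiv.withLpProdComm 2 ℝ F E).toContinuousLinearEquiv

theorem Regular.continuous_fourierSnd (hk : Module.finrank ℝ (WithLp 2 (E × F)) < 2 * k)
    (hh : Regular k h) : Continuous (fourierSnd h) := by
  rw [fourierSnd_eq]
  exact (hh.comp_prodComm.continuous_fourierFst (finrank_withLp_prod_comm.trans_lt hk)).comp
    (LinearIsometryEquiv.continuous _)

theorem Regular.weighted_fourierFst (hk : Module.finrank ℝ (WithLp 2 (E × F)) < 2 * k)
    (hh : Regular k h) : Weighted k (fourierFst h) := by
  rw [fourierFst_eq]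
  exact (hh.comp_prodComm.weighted_fourierSnd (finrank_withLp_prod_comm.trans_lt hk)).comp
    (LinearIsometryEquiv.withLpProdComm 2 ℝ E F).toContinuousLinearEquiv

theorem Regular.integrable_slice_right (hk : Module.finrank ℝ (WithLp 2 (E × F)) < 2 * k)
    (hh : Regular k h) (x : E) : Integrable (fun y : F => h (WithLp.toLp 2 (x, y))) :=
  hh.comp_prodComm.integrable_slice_left (finrank_withLp_prod_comm.trans_lt hk) x

theorem fourier_fourierSnd (hk : Module.finrank ℝ (WithLp 2 (E × F)) < 2 * k) (hh : Regular k h) :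
    𝓕 (fourierSnd h) = fun z => fourierFst h (WithLp.toLp 2 (z.fst, -z.snd)) := by
  have h1 := hh.weighted.integrable hk
  have h2 := (hh.weighted_fourierSnd hk).integrable hk
  rw [← fourierFst_fourierSnd h2]
  ext z
  simp only [fourierFst]
  -- Inversion in the second variable needs an integrable slice, so holds for almost every `x` only.
  apply Real.fourier_congr_ae
  filter_upwards [ae_integrable_slice_right h1, ae_integrable_slice_right h2] with x hx1 hx2
  exact fourier_fourier_eq (hh.continuous.comp (by fun_prop)) hx1 hx2 z.snd

theorem Regular.regular_fourierSnd (hk : Module.finrank ℝ (WithLp 2 (E × F)) < 2 * k)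
    (hh : Regular k h) : Regular k (fourierSnd h) := by
  refine ⟨hh.continuous_fourierSnd hk, hh.weighted_fourierSnd hk, ?_⟩
  rw [fourier_fourierSnd hk hh]
  exact (hh.weighted_fourierFst hk).comp ((LinearIsometryEquiv.refl ℝ E).withLpProdCongr 2
    (LinearIsometryEquiv.neg ℝ (E := F))).toContinuousLinearEquiv

theorem Regular.regular_fourierFst (hk : Module.finrank ℝ (WithLp 2 (E × F)) < 2 * k)
    (hh : Regular k h) : Regular k (fourierFst h) := by
  rw [fourierFst_eq]
  exact (hh.comp_prodComm.regular_fourierSnd (finrank_withLp_prod_comm.trans_lt hk)).comp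
    (LinearIsometryEquiv.withLpProdComm 2 ℝ E F).toContinuousLinearEquiv

theorem fourierSnd_fourierFst (hh : Integrable h) :
    fourierSnd (fourierFst h) = 𝓕 h := by
  have h1 : Integrable (h ∘ LinearIsometryEquiv.withLpProdComm 2 ℝ F E) :=
    ((LinearIsometryEquiv.withLpProdComm 2 ℝ F E).measurePreserving.integrable_comp_emb
      (LinearIsometryEquiv.withLpProdComm 2 ℝ F E).toHomeomorph.measurableEmbedding).2 hh
  rw [fourierSnd_eq, fourierFst_eq]
  ext w
  have h2 := congrFun (fourierFst_fourierSnd h1) (LinearIsometryEquiv.withLpProdComm 2 ℝ E F w)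
  have h3 := Real.fourier_comp_linearIsometry (LinearIsometryEquiv.withLpProdComm 2 ℝ F E) h
    (LinearIsometryEquiv.withLpProdComm 2 ℝ E F w)
  rw [h3] at h2
  exact h2

/-- Projection-slice theorem: integrating `𝓕 h` over the second variable gives the Fourier transform of
the restriction of `h` to the plane `y = 0`. -/
theorem integral_fourier_slice (hk : Module.finrank ℝ (WithLp 2 (E × F)) < 2 * k)
    (hh : Regular k h) (x : E) :
    ∫ y : F, 𝓕 h (WithLp.toLp 2 (x, y)) = fourierFst h (WithLp.toLp 2 (x, 0)) := by
  have hK := hh.regular_fourierFst hk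
  have h1 := hK.integrable_slice_right hk x
  have h2 := (hK.regular_fourierSnd hk).integrable_slice_right hk x
  have hc : Continuous (fun y : F => fourierFst h (WithLp.toLp 2 (x, y))) :=
    hK.continuous.comp (by fun_prop)
  rw [← fourierSnd_fourierFst (hh.weighted.integrable hk)]
  have h3 := congrFun (hc.fourierInv_fourier_eq h1 h2) 0
  rw [Real.fourierInv_eq] at h3
  simp only [inner_zero_right, AddChar.map_zero_eq_one, one_smul] at h3
  exact h3

end Product

/-! ### The Sobolev spaces and `𝒱` -/

section Sobolev

variable {X : Type*} [NormedAddCommGroup X] [InnerProductSpace ℝ X] [FiniteDimensional ℝ X]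
  [MeasurableSpace X] [BorelSpace X]

/-- The homothety `x ↦ (2π)⁻¹ x`, which relates the two normalizations of the Fourier transform. -/
noncomputable def scaling (X : Type*) [NormedAddCommGroup X] [InnerProductSpace ℝ X] : X ≃L[ℝ] X :=
  ContinuousLinearEquiv.smulLeft (Units.mk0 ((2 * Real.pi)⁻¹ : ℝ) (by positivity))

theorem scaling_apply (x : X) : scaling X x = (2 * Real.pi)⁻¹ • x := rfl

theorem integral_comp_scaling (h : X → ℂ) :
    ∫ x, h (scaling X x) = ((2 * Real.pi : ℝ) : ℂ) ^ Module.finrank ℝ X * ∫ x, h x := by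
  simp only [scaling_apply]
  rw [Measure.integral_comp_inv_smul_of_nonneg _ _ (by positivity)]
  rw [Complex.real_smul, Complex.ofReal_pow]

theorem ae_eq_comp_linearEquiv {f g : X → ℂ} (A : X ≃L[ℝ] X) (h : f =ᵐ[volume] g) :
    f ∘ A =ᵐ[volume] g ∘ A := by
  obtain ⟨c, hc⟩ := exists_map_volume_eq A
  refine ae_eq_comp A.continuous.aemeasurable ?_
  rw [hc]
  exact Measure.ae_smul_measure h c

theorem fourierL2_eq {ψ : X → ℂ} (h : MemLp ψ 2) :
    fourierL2 ψ = fun x => ((2 * Real.pi : ℝ) : ℂ)⁻¹ ^ Module.finrank ℝ X *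
      ((𝓕 (h.toLp ψ) : Lp ℂ 2 (volume : Measure X)) ∘ scaling X) x := by
  ext x
  simp only [fourierL2, h, dif_pos]
  rfl

theorem memLp_fourierL2 {ψ : X → ℂ} (h : MemLp ψ 2) : MemLp (fourierL2 ψ) 2 := by
  rw [fourierL2_eq h]
  exact (memLp_comp_linearEquiv _ (Lp.memLp _)).const_mul _

theorem fourierL2_ae_eq {ψ : X → ℂ} (h1 : Integrable ψ) (h2 : MemLp ψ 2) :
    fourierL2 ψ =ᵐ[volume] fun x => ((2 * Real.pi : ℝ) : ℂ)⁻¹ ^ Module.finrank ℝ X *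
      (𝓕 ψ ∘ scaling X) x := by
  rw [fourierL2_eq h2]
  filter_upwards [ae_eq_comp_linearEquiv (scaling X) (fourier_toLp_ae_eq h1 h2)] with x hx
  rw [hx]

theorem memSobolev_iff {k : ℕ} {ψ : X → ℂ} :
    MemSobolev k ψ ↔ MemLp ψ 2 ∧ Weighted k (fourierL2 ψ) :=
  and_congr_right fun h => by rw [weighted_iff, and_iff_right (memLp_fourierL2 h)]

theorem MemSobolev.weighted_fourier_toLp {k : ℕ} {ψ : X → ℂ} (h : MemSobolev k ψ) :
    Weighted k (𝓕 (h.1.toLp ψ) : Lp ℂ 2 (volume : Measure X)) := by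
  have h1 := (memSobolev_iff.1 h).2
  rw [fourierL2_eq h.1] at h1
  have h2 := (h1.const_mul (((2 * Real.pi : ℝ) : ℂ) ^ Module.finrank ℝ X)).comp (scaling X).symm
  convert h2 using 1
  ext x
  have h3 : ((2 * Real.pi : ℝ) : ℂ) ≠ 0 := by exact_mod_cast Real.two_pi_pos.ne'
  simp only [Function.comp_apply, ContinuousLinearEquiv.apply_symm_apply]
  rw [← mul_assoc, ← mul_pow, mul_inv_cancel₀ h3, one_pow, one_mul]

/-- The representative is the Fourier inversion integral of the `L²` Fourier transform, which is
integrable by its decay. -/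
theorem MemSobolev.exists_regular {k : ℕ} (hk : Module.finrank ℝ X < 2 * k) {ψ : X → ℂ}
    (h : MemSobolev k ψ) (hw : Weighted k ψ) : ∃ ψ₀ : X → ℂ, Regular k ψ₀ ∧ ψ₀ =ᵐ[volume] ψ := by
  set G : Lp ℂ 2 (volume : Measure X) := 𝓕 (h.1.toLp ψ) with hG
  have hGw : Weighted k G := h.weighted_fourier_toLp
  have hGi := hGw.integrable hk
  have h1 : (𝓕⁻ (G : X → ℂ)) =ᵐ[volume] ψ := by
    have h2 := fourierInv_toLp_ae_eq hGi (Lp.memLp G)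
    rw [Lp.toLp_coeFn, hG, FourierTransform.fourierInv_fourier_eq] at h2
    exact h2.symm.trans h.1.coeFn_toLp
  have hw' : Weighted k (𝓕⁻ (G : X → ℂ)) := hw.congr_ae h1.symm
  refine ⟨𝓕⁻ (G : X → ℂ), ⟨continuous_fourierInv hGi, hw', hGw.congr_ae ?_⟩, h1⟩
  refine Filter.EventuallyEq.trans ?_ (fourier_toLp_ae_eq (hw'.integrable hk) hw'.memLp)
  rw [(MemLp.toLp_eq_toLp_iff hw'.memLp h.1).2 h1]

theorem Regular.memSobolev {k : ℕ} (hk : Module.finrank ℝ X < 2 * k) {ψ : X → ℂ}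
    (h : Regular k ψ) : MemSobolev k ψ := by
  rw [memSobolev_iff]
  exact ⟨h.weighted.memLp, ((h.weighted_fourier.comp (scaling X)).const_mul _).congr_ae
    (fourierL2_ae_eq (h.weighted.integrable hk) h.weighted.memLp).symm⟩

/-- The function `φ` is the inverse Fourier transform of `ψ` in the `fourierL2` normalization, that is
`φ x = ∫ exp(i x·y) ψ y dy`. -/
theorem Regular.exists_eq_fourierL2 {k : ℕ} (hk : Module.finrank ℝ X < 2 * k) {ψ : X → ℂ}
    (h : Regular k ψ) : ∃ φ : X → ℂ, MemSobolev k φ ∧ ψ =ᵐ[volume] fourierL2 φ := by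
  have hF : Regular k (𝓕⁻ ψ) := by
    rw [show 𝓕⁻ ψ = 𝓕 ψ ∘ ContinuousLinearEquiv.neg ℝ (M := X) from
      funext fun x => Real.fourierInv_eq_fourier_neg ψ x]
    exact (h.fourier hk).comp _
  have hφ := hF.comp (scaling X)
  refine ⟨_, hφ.memSobolev hk, ?_⟩
  refine Filter.EventuallyEq.symm
    ((fourierL2_ae_eq (hφ.weighted.integrable hk) hφ.weighted.memLp).trans (ae_of_all _ fun x => ?_))
  have h1 : 𝓕 (𝓕⁻ ψ ∘ scaling X) (scaling X x) =
      ((2 * Real.pi : ℝ) : ℂ) ^ Module.finrank ℝ X * 𝓕 (𝓕⁻ ψ) x := by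
    rw [Real.fourier_eq, Real.fourier_eq, ← integral_comp_scaling]
    simp only [scaling_apply, inner_smul_left, inner_smul_right, Function.comp_apply]
    rfl
  have h3 : ((2 * Real.pi : ℝ) : ℂ) ≠ 0 := by exact_mod_cast Real.two_pi_pos.ne'
  simp only [Function.comp_apply] at h1 ⊢
  erw [h1]
  rw [← mul_assoc, ← mul_pow, inv_mul_cancel₀ h3, one_pow, one_mul,
    h.continuous.fourier_fourierInv_eq (h.weighted.integrable hk) (h.weighted_fourier.integrable hk)]

end Sobolev

section Phase

variable {n : ℕ}

theorem finrank_phase_lt (n : ℕ) : Module.finrank ℝ (Phase n) < 2 * (n + 1) := by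
  have h : Module.finrank ℝ (Phase n) = n + n := by
    rw [(WithLp.linearEquiv 2 ℝ _).finrank_eq, Module.finrank_prod, finrank_euclideanSpace_fin]
  omega

theorem MemV.exists_regular {ψ : Phase n → ℂ} (h : MemV ψ) :
    ∃ ψ₀ : Phase n → ℂ, Regular (n + 1) ψ₀ ∧ ψ₀ =ᵐ[volume] ψ := by
  obtain ⟨h1, φ, h2, h3⟩ := h
  exact h1.exists_regular (finrank_phase_lt n) ((memSobolev_iff.1 h2).2.congr_ae h3.symm)

theorem Regular.memV {ψ : Phase n → ℂ} (h : Regular (n + 1) ψ) : MemV ψ :=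
  ⟨h.memSobolev (finrank_phase_lt n), h.exists_eq_fourierL2 (finrank_phase_lt n)⟩

end Phase

/-! ### Characteristic function, Wigner function and tomogram -/

variable {n : ℕ}

theorem phase_ext {z w : Phase n} (h1 : ∀ i, z.fst i = w.fst i) (h2 : ∀ i, z.snd i = w.snd i) :
    z = w :=
  (WithLp.ofLp_injective 2) (Prod.ext (PiLp.ext h1) (PiLp.ext h2))

/-- The change of variables `(t, y) ↦ (t + y/2, t - y/2)`. -/
noncomputable def midpointLinearEquiv (n : ℕ) : Phase n ≃ₗ[ℝ] Phase n where
  toFun z := mk (z.fst + (1 / 2 : ℝ) • z.snd) (z.fst - (1 / 2 : ℝ) • z.snd)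
  invFun w := mk ((1 / 2 : ℝ) • (w.fst + w.snd)) (w.fst - w.snd)
  map_add' z w := by
    apply phase_ext <;> intro i <;>
      simp only [WithLp.toLp_fst, WithLp.toLp_snd, WithLp.add_fst, WithLp.add_snd, PiLp.add_apply,
        PiLp.sub_apply, PiLp.smul_apply, smul_eq_mul] <;> ring
  map_smul' c z := by
    apply phase_ext <;> intro i <;>
      simp only [WithLp.toLp_fst, WithLp.toLp_snd, WithLp.smul_fst, WithLp.smul_snd, PiLp.add_apply,
        PiLp.sub_apply, PiLp.smul_apply, smul_eq_mul, RingHom.id_apply] <;> ring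
  left_inv z := by
    apply phase_ext <;> intro i <;>
      simp only [WithLp.toLp_fst, WithLp.toLp_snd, PiLp.add_apply,
        PiLp.sub_apply, PiLp.smul_apply, smul_eq_mul] <;> ring
  right_inv w := by
    apply phase_ext <;> intro i <;>
      simp only [WithLp.toLp_fst, WithLp.toLp_snd, PiLp.add_apply,
        PiLp.sub_apply, PiLp.smul_apply, smul_eq_mul] <;> ring

/-- `midpointLinearEquiv` as a continuous linear equivalence. -/
noncomputable def midpointEquiv (n : ℕ) : Phase n ≃L[ℝ] Phase n :=
  { midpointLinearEquiv n with
    continuous_toFun := by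
      change Continuous fun z : Phase n =>
        mk (z.fst + (1 / 2 : ℝ) • z.snd) (z.fst - (1 / 2 : ℝ) • z.snd)
      fun_prop
    continuous_invFun := by
      change Continuous fun w : Phase n => mk ((1 / 2 : ℝ) • (w.fst + w.snd)) (w.fst - w.snd)
      fun_prop }

theorem midpointEquiv_mk (t y : EuclideanSpace ℝ (Fin n)) :
    midpointEquiv n (mk t y) = mk (t + (1 / 2 : ℝ) • y) (t - (1 / 2 : ℝ) • y) := rfl

theorem fourierChar_coe (a : ℝ) :
    (Real.fourierChar a : ℂ) = Complex.exp (Complex.I * ((2 * Real.pi * a : ℝ) : ℂ)) := by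
  rw [Real.fourierChar_apply, mul_comm]

/-- The change of variables `(x, y) ↦ (-x / (2π), y)`. -/
noncomputable def fstScaling (n : ℕ) : Phase n ≃L[ℝ] Phase n :=
  ((WithLp.prodContinuousLinearEquiv 2 ℝ _ _).trans
    (((scaling _).trans (ContinuousLinearEquiv.neg ℝ)).prodCongr
      (ContinuousLinearEquiv.refl ℝ _))).trans (WithLp.prodContinuousLinearEquiv 2 ℝ _ _).symm

theorem fstScaling_apply (z : Phase n) :
    fstScaling n z = mk (-((2 * Real.pi)⁻¹ • z.fst)) z.snd := rfl

theorem charFn_eq (ρ : Phase n → ℂ) :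
    charFn ρ = fourierFst (ρ ∘ midpointEquiv n) ∘ fstScaling n := by
  ext z
  simp only [charFn, fourierFst, Function.comp_apply, fstScaling_apply, Real.fourier_eq,
    Circle.smul_def, fourierChar_coe, smul_eq_mul, midpointEquiv_mk, WithLp.toLp_fst,
    WithLp.toLp_snd]
  congr 1 with t
  congr 3
  have := Real.pi_pos.ne'
  rw [inner_neg_right, neg_neg, inner_smul_right, real_inner_comm]
  field_simp

/-- The map `(x, s) ↦ (x cos α - s sin α, x sin α + s cos α)`, a rotation in each coordinate plane
`(qⱼ, pⱼ)`. -/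
noncomputable def planeRotation (α : Fin n → ℝ) : Phase n ≃ₗᵢ[ℝ] Phase n :=
  LinearIsometry.toLinearIsometryEquiv
    { toFun := fun z => planePoint α z.fst z.snd
      map_add' := fun z w => by
        apply phase_ext <;> intro i <;> simp [planePoint, cosVec, sinVec] <;> ring
      map_smul' := fun c z => by
        apply phase_ext <;> intro i <;> simp [planePoint, cosVec, sinVec] <;> ring
      norm_map' := fun z => by
        simp only [LinearMap.coe_mk, AddHom.coe_mk]
        rw [WithLp.prod_norm_eq_of_L2, WithLp.prod_norm_eq_of_L2]
        congr 1
        simp only [EuclideanSpace.norm_sq_eq, ← Finset.sum_add_distrib, Real.norm_eq_abs, sq_abs]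
        refine Finset.sum_congr rfl fun j _ => ?_
        simp [planePoint, cosVec, sinVec]
        linear_combination (z.fst j ^ 2 + z.snd j ^ 2) * Real.sin_sq_add_cos_sq (α j) } rfl

theorem planeRotation_mk (α : Fin n → ℝ) (x s : EuclideanSpace ℝ (Fin n)) :
    planeRotation α (mk x s) = planePoint α x s := rfl

theorem planePoint_zero (α : Fin n → ℝ) (x : EuclideanSpace ℝ (Fin n)) :
    planePoint α x 0 = mk (cosVec α x) (sinVec α x) := by
  apply phase_ext <;> intro i <;> simp [planePoint, cosVec, sinVec]

theorem wigner_eq (f : Phase n → ℂ) :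
    wigner f = fun w => ((2 * Real.pi : ℝ) : ℂ)⁻¹ ^ n * (𝓕 f ∘ scaling (Phase n)) w := by
  ext w
  simp only [wigner, Function.comp_apply, scaling_apply, Real.fourier_eq, Circle.smul_def,
    fourierChar_coe, smul_eq_mul]
  congr 2 with z
  congr 1
  rw [inner_smul_right, real_inner_comm w z, WithLp.prod_inner_apply, mul_neg,
    mul_inv_cancel_left₀ (by positivity), Complex.ofReal_neg, mul_neg]
  rfl

theorem tomogramFourier_eq (f : Phase n → ℂ) (α : Fin n → ℝ) :
    tomogramFourier f α = fun x => ((2 * Real.pi : ℝ) : ℂ)⁻¹ ^ n *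
      fourierFst (f ∘ planeRotation α) (mk (scaling _ x) 0) := by
  ext x
  simp only [tomogramFourier, fourierFst, Function.comp_apply, scaling_apply, Real.fourier_eq,
    Circle.smul_def, fourierChar_coe, smul_eq_mul, planeRotation_mk]
  congr 2 with t
  simp only [WithLp.toLp_snd, planePoint_zero, WithLp.toLp_fst]
  congr 2
  rw [inner_smul_right, real_inner_comm, mul_neg,
    mul_inv_cancel_left₀ (by positivity), Complex.ofReal_neg, mul_neg]

/-- In the coordinates `(x, s)` of `planeRotation α`, which commutes with the Fourier transform, this is
`integral_fourier_slice`. -/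
theorem tomogramRadon_wigner {f : Phase n → ℂ} (hf : Regular (n + 1) f) (α : Fin n → ℝ)
    (x : EuclideanSpace ℝ (Fin n)) : tomogramRadon (wigner f) α x = tomogramFourier f α x := by
  have h1 : ∀ s, wigner f (planePoint α x s) = ((2 * Real.pi : ℝ) : ℂ)⁻¹ ^ n *
      𝓕 (f ∘ planeRotation α) (mk (scaling _ x) (scaling _ s)) := fun s => by
    rw [wigner_eq, Real.fourier_comp_linearIsometry, ← planeRotation_mk]
    simp only [Function.comp_apply]
    rw [scaling_apply, ← map_smul]
    rfl
  have h2 := hf.comp (planeRotation α).toContinuousLinearEquiv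
  have h3 : ((2 * Real.pi : ℝ) : ℂ) ≠ 0 := by exact_mod_cast Real.two_pi_pos.ne'
  rw [tomogramRadon, tomogramFourier_eq]
  simp only [h1]
  rw [integral_const_mul,
    integral_comp_scaling (fun s => 𝓕 (f ∘ planeRotation α) (mk (scaling _ x) s)),
    finrank_euclideanSpace_fin, ← mul_assoc (_⁻¹ ^ n) (((2 * Real.pi : ℝ) : ℂ) ^ n), ← mul_pow,
    inv_mul_cancel₀ h3, one_pow, one_mul]
  congr 1
  exact integral_fourier_slice (finrank_phase_lt n) h2 (scaling _ x)

theorem Regular.regular_charFn {ρ : Phase n → ℂ} (hρ : Regular (n + 1) ρ) :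
    Regular (n + 1) (charFn ρ) := by
  rw [charFn_eq]
  exact ((hρ.comp _).regular_fourierFst (finrank_phase_lt n)).comp _

theorem Regular.regular_wigner {f : Phase n → ℂ} (hf : Regular (n + 1) f) :
    Regular (n + 1) (wigner f) := by
  rw [wigner_eq]
  exact ((hf.fourier (finrank_phase_lt n)).comp (scaling _)).const_mul _

theorem Regular.integrable_planePoint {f : Phase n → ℂ} (hf : Regular (n + 1) f) (α : Fin n → ℝ)
    (x : EuclideanSpace ℝ (Fin n)) : Integrable (fun s => f (planePoint α x s)) :=
  (hf.comp (planeRotation α).toContinuousLinearEquiv).integrable_slice_right (finrank_phase_lt n) x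

theorem Regular.integrable_cosVec_sinVec {f : Phase n → ℂ} (hf : Regular (n + 1) f)
    (α : Fin n → ℝ) : Integrable (fun t => f (QuantumTomography.mk (cosVec α t) (sinVec α t))) := by
  simp only [← planePoint_zero]
  exact (hf.comp (planeRotation α).toContinuousLinearEquiv).integrable_slice_left
    (finrank_phase_lt n) 0

theorem Regular.continuous_tomogramFourier {f : Phase n → ℂ} (hf : Regular (n + 1) f)
    (α : Fin n → ℝ) : Continuous (tomogramFourier f α) := by
  rw [tomogramFourier_eq]
  have h := ((hf.comp (planeRotation α).toContinuousLinearEquiv).regular_fourierFst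
    (finrank_phase_lt n)).continuous
  exact continuous_const.mul (h.comp (by fun_prop))

theorem Regular.integrable_tomogramFourier {f : Phase n → ℂ} (hf : Regular (n + 1) f)
    (α : Fin n → ℝ) : Integrable (tomogramFourier f α) := by
  rw [tomogramFourier_eq]
  have h := ((hf.comp (planeRotation α).toContinuousLinearEquiv).regular_fourierFst
    (finrank_phase_lt n)).integrable_slice_left (finrank_phase_lt n) 0
  refine Integrable.const_mul ?_ _
  have h2 := h.comp_smul (R := (2 * Real.pi)⁻¹) (by positivity)
  exact h2

end QuantumTomography

theorem theorem1 (n : ℕ) (ρ : Phase n → ℂ) (hρ : MemV ρ) :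
    -- `ρ` has a continuous representative
    (∃ ρ₀ : Phase n → ℂ, Continuous ρ₀ ∧ ρ₀ =ᵐ[volume] ρ) ∧
    ∀ ρ₀ : Phase n → ℂ, Continuous ρ₀ → ρ₀ =ᵐ[volume] ρ →
      -- the characteristic function is well defined at every point, continuous, and lies in `𝒱`
      (∀ y : EuclideanSpace ℝ (Fin n),
        Integrable (fun t : EuclideanSpace ℝ (Fin n) =>
          ρ₀ (mk (t + (1 / 2 : ℝ) • y) (t - (1 / 2 : ℝ) • y)))) ∧
      Continuous (charFn ρ₀) ∧
      MemV (charFn ρ₀) ∧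
      -- the Wigner function is well defined at every point, continuous, and lies in `𝒱`
      Integrable (charFn ρ₀) ∧
      Continuous (wigner (charFn ρ₀)) ∧
      MemV (wigner (charFn ρ₀)) ∧
      ∀ α : Fin n → ℝ, (∀ j, α j ∈ Set.Icc 0 (2 * Real.pi)) →
        -- both formulas for the tomogram converge absolutely and agree
        Integrable (fun t : EuclideanSpace ℝ (Fin n) =>
          charFn ρ₀ (mk (cosVec α t) (sinVec α t))) ∧
        (∀ x : EuclideanSpace ℝ (Fin n),
          Integrable (fun s : EuclideanSpace ℝ (Fin n) =>
            wigner (charFn ρ₀) (planePoint α x s))) ∧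
        (∀ x : EuclideanSpace ℝ (Fin n),
          tomogramFourier (charFn ρ₀) α x = tomogramRadon (wigner (charFn ρ₀)) α x) ∧
        -- the tomogram lies in `C(ℝⁿ) ∩ L₁(ℝⁿ)`
        Continuous (tomogramFourier (charFn ρ₀) α) ∧
        Integrable (tomogramFourier (charFn ρ₀) α) := by
  obtain ⟨ρ₁, hρ₁, hρ₁ρ⟩ := hρ.exists_regular
  refine ⟨⟨ρ₁, hρ₁.continuous, hρ₁ρ⟩, fun ρ₀ hc hρ₀ => ?_⟩
  obtain rfl : ρ₀ = ρ₁ := (hc.ae_eq_iff_eq volume hρ₁.continuous).1 (hρ₀.trans hρ₁ρ.symm)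
  have hk := finrank_phase_lt n
  have hf := hρ₁.regular_charFn
  have hW := hf.regular_wigner
  refine ⟨fun y => (hρ₁.comp (midpointEquiv n)).integrable_slice_left hk y, hf.continuous, hf.memV,
    hf.weighted.integrable hk, hW.continuous, hW.memV, fun α _ => ?_⟩
  exact ⟨hf.integrable_cosVec_sinVec α, hW.integrable_planePoint α,
    fun x => (tomogramRadon_wigner hf α x).symm, hf.continuous_tomogramFourier α,
    hf.integrable_tomogramFourier α⟩
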